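/- Let $\mathbb{F}_q$ be a finite field of order $q$, let $N,M$ be positive integers, let $H$ be an $(N+M)$-dimensional vector space over $\mathbb{F}_q$, and let $h\subseteq H$ be a subspace of dimension $M$. Let $P$ be the set of subspaces $x$ of $H$ with $x\cap h=0$, partially ordered by inclusion, let $\mathbb{C}P$ be the complex vector space with basis $P$, and let $\mathrm{Mat}_P(\mathbb{C})$ act on $\mathbb{C}P$ by $Ay=\sum_{x\in P}A_{xy}\,x$ for $y\in P$. Define $L,R,K\in\mathrm{Mat}_P(\mathbb{C})$ as follows: $L_{xy}=1$ if $y$ covers $x$ and $L_{xy}=0$ otherwise; $R_{xy}=1$ if $x$ covers $y$ and $R_{xy}=0$ otherwise; $K=\sum_{i=0}^{N}q^{N+M-i}F_i$, where $F_i$ is the diagonal matrix with $(F_i)_{yy}=1$ if $\dim y=i$ and $(F_i)_{yy}=0$ otherwise. Put $$C_1=q^{-1}(q-1)^{-1}(q+1)K+RL-q^{-1}LR,\qquad C_2=K^2+(q-1)RLK-(q-1)LRK .$$ For a nonzero $\tau\in\mathbb{C}$ that is not a root of unity, distinct integers $s,t$, and a Laurent polynomial $\phi\in\mathbb{C}[\vartheta^{\pm1}]$,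 the augmented down-up algebra $\mathbb{A}_\tau(s,t,\phi)$ is the $\mathbb{C}$-algebra with generators $\mathcal{K}^{\pm1},E,F,\mathcal{C}_s,\mathcal{C}_t$ and relations: $\mathcal{K}\mathcal{K}^{-1}=\mathcal{K}^{-1}\mathcal{K}=1$; $\mathcal{C}_s,\mathcal{C}_t$ are central; $\mathcal{K}E=\tau^2E\mathcal{K}$; $\mathcal{K}F=\tau^{-2}F\mathcal{K}$; $$FE=\mathcal{C}_s\tau^s\mathcal{K}^s+\mathcal{C}_t\tau^t\mathcal{K}^t+\phi(\tau\mathcal{K}),\qquad EF=\mathcal{C}_s\tau^{-s}\mathcal{K}^s+\mathcal{C}_t\tau^{-t}\mathcal{K}^t+\phi(\tau^{-1}\mathcal{K}).$$ Let $\tau\in\mathbb{C}$ be a square root of $q$ (so $\tau$ is nonzero and not a root of unity), and let $s=-1$, $t=0$, $\phi=-\tau(\tau^2-1)^{-2}\vartheta$. Then the vector space $\mathbb{C}P$ has an $\mathbb{A}_\tau(s,t,\phi)$-module structure on which $\mathcal{K}$ acts as $K$, $E$ acts as $L$, $F$ acts as $R$, $\mathcal{C}_s$ acts as $-\dfrac{\tau}{(\tau^2-1)^2}\,C_2$,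 and $\mathcal{C}_t$ acts as $\dfrac{\tau^2}{\tau^2-1}\,C_1$. -/

import Mathlib

noncomputable section

/-! ### The attenuated space poset and the matrices `L`, `R`, `F_i`, `K`, `C_1`, `C_2` -/

section AttenuatedSpace

variable {F : Type*} [Field F] {H : Type*} [AddCommGroup H] [Module F H]

/-- The attenuated space poset: the subspaces of `H` that meet `h` trivially,
ordered by inclusion (the order is inherited from `Submodule F H`). -/
abbrev AttenuatedSpace (h : Submodule F H) : Type _ :=
  {x : Submodule F H // x ⊓ h = ⊥}

namespace AttenuatedSpace

variable (h : Submodule F H)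

instance [Finite F] [Module.Finite F H] : Finite (AttenuatedSpace h) := by
  have : Finite H := Module.finite_of_finite F
  have : Finite (Submodule F H) := Finite.of_injective _ SetLike.coe_injective
  infer_instance

instance [Finite F] [Module.Finite F H] : Fintype (AttenuatedSpace h) := Fintype.ofFinite _

instance : DecidableEq (AttenuatedSpace h) := Classical.decEq _

/-- The vector space `ℂP` of formal `ℂ`-linear combinations of elements of the poset `P`. -/
abbrev CP : Type _ := AttenuatedSpace h →₀ ℂ

open Classical in
/-- The lowering matrix: the `(x, y)`-entry is `1` if `y` covers `x`, and `0` otherwise. -/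
def lowering : Matrix (AttenuatedSpace h) (AttenuatedSpace h) ℂ :=
  Matrix.of fun x y => if x ⋖ y then 1 else 0

open Classical in
/-- The raising matrix: the `(x, y)`-entry is `1` if `x` covers `y`, and `0` otherwise. -/
def raising : Matrix (AttenuatedSpace h) (AttenuatedSpace h) ℂ :=
  Matrix.of fun x y => if y ⋖ x then 1 else 0

/-- The `i`-th projection matrix: the diagonal matrix whose `(y, y)`-entry is `1` if `y` has
dimension `i`, and `0` otherwise. -/
def proj (i : ℕ) : Matrix (AttenuatedSpace h) (AttenuatedSpace h) ℂ :=
  Matrix.diagonal fun y => if Module.finrank F y.1 = i then 1 else 0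

/-- The diagonal matrix `K = ∑_{i=0}^N q^{N+M-i} F_i`, where `q` is the order of `F`. -/
def matK (N M : ℕ) : Matrix (AttenuatedSpace h) (AttenuatedSpace h) ℂ :=
  ∑ i ∈ Finset.range (N + 1), ((Nat.card F : ℂ) ^ ((N : ℤ) + (M : ℤ) - (i : ℤ))) • proj h i

variable [Finite F] [Module.Finite F H]

/-- `C_1 = q⁻¹ (q - 1)⁻¹ (q + 1) K + R L - q⁻¹ L R`. -/
def matC₁ (N M : ℕ) : Matrix (AttenuatedSpace h) (AttenuatedSpace h) ℂ :=
  ((Nat.card F : ℂ)⁻¹ * ((Nat.card F : ℂ) - 1)⁻¹ * ((Nat.card F : ℂ) + 1)) • matK h N M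
    + raising h * lowering h - (Nat.card F : ℂ)⁻¹ • (lowering h * raising h)

/-- `C_2 = K² + (q - 1) R L K - (q - 1) L R K`. -/
def matC₂ (N M : ℕ) : Matrix (AttenuatedSpace h) (AttenuatedSpace h) ℂ :=
  matK h N M ^ 2
    + ((Nat.card F : ℂ) - 1) • (raising h * lowering h * matK h N M)
    - ((Nat.card F : ℂ) - 1) • (lowering h * raising h * matK h N M)

/-- The action of a matrix in `Mat_P(ℂ)` on `ℂP` with respect to the basis `P`:
`A y = ∑ x, A x y • x` for `y` in `P`. -/
def act (A : Matrix (AttenuatedSpace h) (AttenuatedSpace h) ℂ) (v : CP h) : CP h :=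
  Matrix.toLin (Finsupp.basisSingleOne (R := ℂ)) (Finsupp.basisSingleOne (R := ℂ)) A v

end AttenuatedSpace

end AttenuatedSpace

/-! ### The augmented down-up algebra -/

namespace AugmentedDownUp

/-- The generators `𝒦`, `𝒦⁻¹`, `E`, `F`, `𝒞_s`, `𝒞_t`. -/
inductive Gen : Type
  | K | Kinv | E | F | Cs | Ct

/-- A generator, viewed in the free algebra. -/
abbrev gen (g : Gen) : FreeAlgebra ℂ Gen := FreeAlgebra.ι ℂ g

/-- The word for the integer power `𝒦ⁿ` : it is `𝒦 ⋯ 𝒦` for `n ≥ 0` and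
`𝒦⁻¹ ⋯ 𝒦⁻¹` for `n < 0`. -/
def powK (n : ℤ) : FreeAlgebra ℂ Gen :=
  if 0 ≤ n then gen .K ^ n.toNat else gen .Kinv ^ (-n).toNat

/-- The expression `φ(c𝒦) = ∑ n, φ_n cⁿ 𝒦ⁿ` for a Laurent polynomial `φ = ∑ n, φ_n ϑⁿ` and a
nonzero scalar `c`. -/
def evalK (φ : LaurentPolynomial ℂ) (c : ℂ) : FreeAlgebra ℂ Gen :=
  ∑ n ∈ φ.coeff.support, (φ.coeff n * c ^ n) • powK n

/-- The defining relations of the augmented down-up algebra. -/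
inductive Rel (τ : ℂ) (s t : ℤ) (φ : LaurentPolynomial ℂ) :
    FreeAlgebra ℂ Gen → FreeAlgebra ℂ Gen → Prop
  | K_mul_Kinv : Rel τ s t φ (gen .K * gen .Kinv) 1
  | Kinv_mul_K : Rel τ s t φ (gen .Kinv * gen .K) 1
  | Cs_central (x : FreeAlgebra ℂ Gen) : Rel τ s t φ (gen .Cs * x) (x * gen .Cs)
  | Ct_central (x : FreeAlgebra ℂ Gen) : Rel τ s t φ (gen .Ct * x) (x * gen .Ct)
  | K_mul_E : Rel τ s t φ (gen .K * gen .E) (τ ^ 2 • (gen .E * gen .K))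
  | K_mul_F : Rel τ s t φ (gen .K * gen .F) (τ ^ (-2 : ℤ) • (gen .F * gen .K))
  | F_mul_E : Rel τ s t φ (gen .F * gen .E)
      (τ ^ s • (gen .Cs * powK s) + τ ^ t • (gen .Ct * powK t) + evalK φ τ)
  | E_mul_F : Rel τ s t φ (gen .E * gen .F)
      (τ ^ (-s) • (gen .Cs * powK s) + τ ^ (-t) • (gen .Ct * powK t) + evalK φ τ⁻¹)

end AugmentedDownUp

/-- The augmented down-up algebra `𝔸_τ(s, t, φ)` (for a nonzero `τ` that is not a root of unity,
distinct integers `s`, `t` and a Laurent polynomial `φ`): the `ℂ`-algebra with the above generators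
and relations. -/
abbrev AugmentedDownUpAlgebra (τ : ℂ) (s t : ℤ) (φ : LaurentPolynomial ℂ) : Type :=
  RingQuot (AugmentedDownUp.Rel τ s t φ)

namespace AugmentedDownUpAlgebra

/-- A generator of `𝔸_τ(s, t, φ)`. -/
def gen (τ : ℂ) (s t : ℤ) (φ : LaurentPolynomial ℂ) (g : AugmentedDownUp.Gen) :
    AugmentedDownUpAlgebra τ s t φ :=
  RingQuot.mkAlgHom ℂ (AugmentedDownUp.Rel τ s t φ) (AugmentedDownUp.gen g)

end AugmentedDownUpAlgebra

/-- The Laurent polynomial `-τ (τ² - 1)⁻² ϑ`. -/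
def downUpPhi (τ : ℂ) : LaurentPolynomial ℂ :=
  LaurentPolynomial.C (-τ * (τ ^ 2 - 1) ^ (-2 : ℤ)) * LaurentPolynomial.T 1

end

/-! ### Counting subspaces over a finite field -/

section Counting

open Module

variable {F : Type*} [Field F] {H : Type*} [AddCommGroup H] [Module F H]

/-! Everything rests on `KL = qLK`, `RK = qKR` and the down-up relation `qRL² - (q+1)LRL + L²R =
-(q+1)LK` together with its transpose. The commutators of `C₁` and `C₂` with `L` and `R` are
multiples of these relations, so `C₁` and `C₂` act centrally. As `s = -1` and `t = 0`, the formulas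
for `FE` and `EF` involve only `C₁`, `C₂K⁻¹` and `K`. Both `C₁` and `C₂K⁻¹` are linear in `RL`,
`LR`, `K`, and the two formulas are this linear system solved for `RL` and `LR`
(`exists_algHom_augmentedDownUpAlgebra`).

The down-up relation (`lowering_relation`) is a count at each entry `(x, y)` with dim y = dim x + 1.
If `y` covers `x`, everything cancels except the difference of the numbers of covers of `x` and of
`y`, which is the entry of `K` at `y`. If `x` is not contained in `y`, only pairs with dim (x + y) =
dim y + 1 contribute. The `LRL` term then counts the covers of `x` in the poset inside x + y: there
are q + 1 of them if x + y is in the poset and q otherwise, while the `L²R` term is q + 1 or 0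
accordingly, so the sum is 0 both times. All the cover counts come from
`Submodule.ncard_covBy_le_not_le`. -/

theorem Submodule.covBy_iff_le_and_finrank_eq [Module.Finite F H] {a b : Submodule F H} :
    a ⋖ b ↔ a ≤ b ∧ finrank F b = finrank F a + 1 := by
  constructor
  · intro hab
    obtain ⟨v, hvb, hva⟩ := SetLike.exists_of_lt hab.lt
    have hb : F ∙ v ⊔ a = b := by
      refine (hab.eq_or_eq le_sup_right (sup_le ?_ hab.le)).resolve_left fun e => hva ?_
      · simpa using hvb
      · rw [← e]
        exact Submodule.mem_sup_left (Submodule.mem_span_singleton_self v)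
    have hv : v ≠ 0 := fun e => hva (e ▸ a.zero_mem)
    have hdisj : F ∙ v ⊓ a = ⊥ :=
      disjoint_iff.1 ((Submodule.disjoint_span_singleton' hv).2 hva).symm
    have := Submodule.finrank_sup_add_finrank_inf_eq (F ∙ v) a
    rw [hb, hdisj, finrank_bot, finrank_span_singleton hv] at this
    exact ⟨hab.le, by omega⟩
  · rintro ⟨hle, hr⟩
    refine ⟨lt_of_le_of_ne hle fun e => by subst e; omega, fun c hac hcb => ?_⟩
    have h1 := Submodule.finrank_lt_finrank_of_lt hac
    have h2 := Submodule.finrank_lt_finrank_of_lt hcb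
    omega

theorem Submodule.natCard_eq_pow [Finite F] [Module.Finite F H] (a : Submodule F H) :
    Nat.card a = Nat.card F ^ finrank F a :=
  Module.natCard_eq_pow_finrank

theorem Submodule.ncard_sdiff [Finite F] [Module.Finite F H] {a b : Submodule F H}
    (hab : a ≤ b) :
    (((b : Set H) \ a).ncard : ℂ)
      = (Nat.card F : ℂ) ^ finrank F b - (Nat.card F : ℂ) ^ finrank F a := by
  have : Finite H := Module.finite_of_finite F
  have h1 := Set.ncard_sdiff_add_ncard_of_subset (s := (a : Set H)) (t := b) hab
  have ha : (a : Set H).ncard = Nat.card F ^ finrank F a := a.natCard_eq_pow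
  have hb : (b : Set H).ncard = Nat.card F ^ finrank F b := b.natCard_eq_pow
  rw [ha, hb] at h1
  rw [eq_sub_iff_add_eq]
  exact_mod_cast h1

/-- The vectors of `b` outside `c` are partitioned by the covers `w` of `a` inside `b` that are not
contained in `c`. -/
theorem Submodule.ncard_covBy_le_not_le [Finite F] [Module.Finite F H] {a b c : Submodule F H}
    (hac : a ≤ c) (hcb : c ≤ b) :
    ({w : Submodule F H | a ⋖ w ∧ w ≤ b ∧ ¬ w ≤ c}.ncard : ℂ)
        * ((Nat.card F : ℂ) ^ (finrank F a + 1) - (Nat.card F : ℂ) ^ finrank F a)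
      = (Nat.card F : ℂ) ^ finrank F b - (Nat.card F : ℂ) ^ finrank F c := by
  classical
  have : Finite H := Module.finite_of_finite F
  have : Finite (Submodule F H) := Finite.of_injective _ SetLike.coe_injective
  have := Fintype.ofFinite H
  have := Fintype.ofFinite (Submodule F H)
  rw [← Submodule.ncard_sdiff hcb, Set.ncard_eq_toFinset_card', Set.ncard_eq_toFinset_card']
  have hmaps : Set.MapsTo (fun v => F ∙ v ⊔ a) (((b : Set H) \ c).toFinset : Set H)
      ({w : Submodule F H | a ⋖ w ∧ w ≤ b ∧ ¬ w ≤ c}.toFinset : Set (Submodule F H)) := by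
    intro v hv
    simp only [Set.coe_toFinset, Set.mem_sdiff, SetLike.mem_coe] at hv
    simp only [Set.coe_toFinset, Set.mem_ofPred_eq]
    refine ⟨covBy_span_singleton_sup fun hva => hv.2 (hac hva),
      sup_le (by simpa using hv.1) (hac.trans hcb), fun hle => hv.2 ?_⟩
    exact hle (Submodule.mem_sup_left (Submodule.mem_span_singleton_self v))
  rw [Finset.card_eq_sum_card_fiberwise hmaps, Nat.cast_sum, ← nsmul_eq_mul,
    ← Finset.sum_const]
  refine Finset.sum_congr rfl fun w hw => ?_
  simp only [Set.mem_toFinset, Set.mem_ofPred_eq] at hw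
  obtain ⟨haw, hwb, hwc⟩ := hw
  rw [← (Submodule.covBy_iff_le_and_finrank_eq.1 haw).2, ← Submodule.ncard_sdiff haw.le,
    Set.ncard_eq_toFinset_card']
  -- The fibre of v ↦ ⟨v⟩ + a over `w` is w ∖ a. Since `w` covers `a` and is not inside `c`, a
  -- vector of `w` outside `a` cannot lie in `c`: it generates `w` over `a`, and `a ≤ c`.
  congr 2
  ext v
  simp only [Set.mem_toFinset, Set.mem_sdiff, SetLike.mem_coe, Finset.mem_filter]
  constructor
  · rintro ⟨hvw, hva⟩
    have e : F ∙ v ⊔ a = w := by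
      refine (haw.eq_or_eq le_sup_right (sup_le ?_ haw.le)).resolve_left fun e => hva ?_
      · simpa using hvw
      · rw [← e]
        exact Submodule.mem_sup_left (Submodule.mem_span_singleton_self v)
    refine ⟨⟨hwb hvw, fun hvc => hwc ?_⟩, e⟩
    rw [← e]
    exact sup_le (by simpa using hvc) hac
  · rintro ⟨⟨-, hvc⟩, rfl⟩
    exact ⟨Submodule.mem_sup_left (Submodule.mem_span_singleton_self v), fun hva => hvc (hac hva)⟩

end Counting

/-! ### Representations of the augmented down-up algebra -/

section Representation

variable {A : Type*} [Ring A] [Algebra ℂ A] {q : ℂ} {K K' L R : A}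

/-- The commutator is q⁻¹ times the difference of the two sides of `hrel`; the coefficient of `K` is
the one that makes this exact. -/
theorem commute_casimir_one_lowering (hq : q ≠ 0) (hq1 : q - 1 ≠ 0)
    (hKL : K * L = q • (L * K))
    (hrel : q • (R * (L * L)) - (q + 1) • (L * (R * L)) + L * (L * R) = -((q + 1) • (L * K))) :
    Commute ((q⁻¹ * (q - 1)⁻¹ * (q + 1)) • K + R * L - q⁻¹ • (L * R)) L := by
  simp only [Commute, SemiconjBy, add_mul, sub_mul, mul_add, mul_sub, smul_mul_assoc,
    mul_smul_comm, mul_assoc, hKL]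
  rw [← sub_eq_zero] at hrel ⊢
  rw [← smul_zero q⁻¹, ← hrel]
  match_scalars <;> field_simp <;> ring

theorem commute_casimir_one_raising (hq : q ≠ 0) (hq1 : q - 1 ≠ 0)
    (hRK : R * K = q • (K * R))
    (hrel : q • (R * (R * L)) - (q + 1) • (R * (L * R)) + L * (R * R) = -((q + 1) • (K * R))) :
    Commute ((q⁻¹ * (q - 1)⁻¹ * (q + 1)) • K + R * L - q⁻¹ • (L * R)) R := by
  simp only [Commute, SemiconjBy, add_mul, sub_mul, mul_add, mul_sub, smul_mul_assoc,
    mul_smul_comm, mul_assoc, hRK]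
  rw [← sub_eq_zero] at hrel ⊢
  rw [← smul_zero (-q⁻¹), ← hrel]
  match_scalars <;> field_simp <;> ring

/-- The commutator is q - 1 times the difference of the two sides of `hrel`, multiplied by `K` on
the right. -/
theorem commute_casimir_two_lowering
    (hKL : K * L = q • (L * K))
    (hrel : q • (R * (L * L)) - (q + 1) • (L * (R * L)) + L * (L * R) = -((q + 1) • (L * K))) :
    Commute (K ^ 2 + (q - 1) • (R * L * K) - (q - 1) • (L * R * K)) L := by
  have hKL' (x : A) : K * (L * x) = q • (L * (K * x)) := by
    rw [← mul_assoc, hKL, smul_mul_assoc, mul_assoc]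
  have hrel' := congrArg (· * K) hrel
  simp only [add_mul, sub_mul, neg_mul, smul_mul_assoc, mul_assoc] at hrel'
  simp only [Commute, SemiconjBy, add_mul, sub_mul, mul_add, mul_sub, smul_mul_assoc,
    mul_smul_comm, mul_assoc, hKL, hKL', pow_two]
  rw [← sub_eq_zero] at hrel' ⊢
  rw [← smul_zero (q - 1), ← hrel']
  match_scalars <;> ring

theorem commute_casimir_two_raising (hq : q ≠ 0)
    (hRK : R * K = q • (K * R))
    (hrel : q • (R * (R * L)) - (q + 1) • (R * (L * R)) + L * (R * R) = -((q + 1) • (K * R))) :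
    Commute (K ^ 2 + (q - 1) • (R * L * K) - (q - 1) • (L * R * K)) R := by
  have hKR : K * R = q⁻¹ • (R * K) := by rw [hRK, smul_smul, inv_mul_cancel₀ hq, one_smul]
  have hKR' (x : A) : K * (R * x) = q⁻¹ • (R * (K * x)) := by
    rw [← mul_assoc, hKR, smul_mul_assoc, mul_assoc]
  have hrel' := congrArg (· * K) hrel
  simp only [add_mul, sub_mul, neg_mul, smul_mul_assoc, mul_assoc] at hrel'
  simp only [hKR'] at hrel'
  simp only [Commute, SemiconjBy, add_mul, sub_mul, mul_add, mul_sub, smul_mul_assoc,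
    mul_smul_comm, mul_assoc, hKR, hKR', pow_two]
  rw [← sub_eq_zero] at hrel' ⊢
  rw [← smul_zero (-((q - 1) * q⁻¹)), ← hrel']
  match_scalars <;> field_simp <;> ring

theorem commute_casimir_one_cartan (hq : q ≠ 0)
    (hKL : K * L = q • (L * K)) (hRK : R * K = q • (K * R)) (c d : ℂ) :
    Commute (c • K + R * L - d • (L * R)) K := by
  have hKR : K * R = q⁻¹ • (R * K) := by rw [hRK, smul_smul, inv_mul_cancel₀ hq, one_smul]
  have h1 : Commute (R * L) K := by
    simp only [Commute, SemiconjBy]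
    rw [← mul_assoc, hKR, smul_mul_assoc, mul_assoc R K, hKL, mul_smul_comm, smul_smul,
      inv_mul_cancel₀ hq, one_smul, mul_assoc]
  have h2 : Commute (L * R) K := by
    simp only [Commute, SemiconjBy]
    rw [← mul_assoc, hKL, smul_mul_assoc, mul_assoc L K, hKR, mul_smul_comm, smul_smul,
      mul_inv_cancel₀ hq, one_smul, mul_assoc]
  exact (((Commute.refl K).smul_left c).add_left h1).sub_left (h2.smul_left d)

theorem commute_casimir_two_cartan (hq : q ≠ 0)
    (hKL : K * L = q • (L * K)) (hRK : R * K = q • (K * R)) :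
    Commute (K ^ 2 + (q - 1) • (R * L * K) - (q - 1) • (L * R * K)) K := by
  -- The coefficients (0, 0) isolate `RL`; the coefficients (0, 1) give `RL - LR`, hence `LR` by
  -- subtraction.
  have h1 : Commute (R * L) K := by
    simpa using commute_casimir_one_cartan hq hKL hRK 0 0
  have h2 : Commute (L * R) K := by
    simpa using h1.sub_left (commute_casimir_one_cartan hq hKL hRK 0 1)
  exact (((Commute.refl K).pow_left 2).add_left
    ((h1.mul_left (Commute.refl K)).smul_left _)).sub_left
    ((h2.mul_left (Commute.refl K)).smul_left _)

/-- The images of the generators under the representation determined by `K`, `K⁻¹`, `L`, `R`. -/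
noncomputable def downUpGenImage (τ : ℂ) (K K' L R C₁ C₂ : A) : AugmentedDownUp.Gen → A
  | .K => K
  | .Kinv => K'
  | .E => L
  | .F => R
  | .Cs => (-(τ / (τ ^ 2 - 1) ^ 2)) • C₂
  | .Ct => (τ ^ 2 / (τ ^ 2 - 1)) • C₁

theorem evalK_downUpPhi (τ c : ℂ) :
    AugmentedDownUp.evalK (downUpPhi τ) c
      = (-τ * (τ ^ 2 - 1) ^ (-2 : ℤ) * c) • AugmentedDownUp.gen .K := by
  have hphi : downUpPhi τ = LaurentPolynomial.C (-τ * (τ ^ 2 - 1) ^ (-2 : ℤ))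
    * LaurentPolynomial.T 1 := rfl
  rw [← LaurentPolynomial.single_eq_C_mul_T] at hphi
  have hc (n : ℤ) : (downUpPhi τ).coeff n
      = if 1 = n then -τ * (τ ^ 2 - 1) ^ (-2 : ℤ) else 0 := by
    rw [hphi]; exact Finsupp.single_apply
  unfold AugmentedDownUp.evalK
  -- The coefficient of `φ` may vanish here, so the support is `{1}` or empty; passing through the
  -- union covers both cases.
  rw [Finset.sum_subset (s₂ := {1} ∪ (downUpPhi τ).coeff.support) Finset.subset_union_right,
    ← Finset.sum_subset (s₁ := {1}) Finset.subset_union_left]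
  · simp [hc, AugmentedDownUp.powK]
  · intro n _ hn
    have : ¬ (1 = n) := fun e => hn (by simp [e])
    simp [hc, this]
  · intro n _ hn
    rw [Finsupp.notMem_support_iff] at hn
    rw [hn, zero_mul, zero_smul]

theorem FreeAlgebra.commute_lift_of_commute_generators {X : Type*} {f : X → A} {c : A}
    (hc : ∀ i, Commute c (f i)) (x : FreeAlgebra ℂ X) :
    Commute c (FreeAlgebra.lift ℂ f x) := by
  induction x using FreeAlgebra.induction with
  | grade0 r => rw [AlgHom.commutes]; exact (Algebra.commutes r c).symm
  | grade1 i => rw [FreeAlgebra.lift_ι_apply]; exact hc i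
  | mul a b ha hb => rw [map_mul]; exact ha.mul_right hb
  | add a b ha hb => rw [map_add]; exact ha.add_right hb

/-- With q = τ², the right side for `FE` has `RL` with coefficient (q - 1)/(q - 1) = 1, `LR` with
coefficient 0, and `K` with coefficient (-1 + (q + 1) - q)/(q - 1)² = 0. The right side for `EF`
collapses to `LR` in the same way. -/
theorem exists_algHom_augmentedDownUpAlgebra (τ : ℂ) (hq : τ ^ 2 ≠ 0) (hq1 : τ ^ 2 - 1 ≠ 0)
    (hKK' : K * K' = 1) (hK'K : K' * K = 1)
    (hKL : K * L = τ ^ 2 • (L * K)) (hRK : R * K = τ ^ 2 • (K * R))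
    (hL : τ ^ 2 • (R * (L * L)) - (τ ^ 2 + 1) • (L * (R * L)) + L * (L * R)
      = -((τ ^ 2 + 1) • (L * K)))
    (hR : τ ^ 2 • (R * (R * L)) - (τ ^ 2 + 1) • (R * (L * R)) + L * (R * R)
      = -((τ ^ 2 + 1) • (K * R)))
    (C₁ C₂ : A)
    (hC₁ : C₁ = ((τ ^ 2)⁻¹ * (τ ^ 2 - 1)⁻¹ * (τ ^ 2 + 1)) • K + R * L - (τ ^ 2)⁻¹ • (L * R))
    (hC₂ : C₂ = K ^ 2 + (τ ^ 2 - 1) • (R * L * K) - (τ ^ 2 - 1) • (L * R * K)) :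
    ∃ f : AugmentedDownUpAlgebra τ (-1) 0 (downUpPhi τ) →ₐ[ℂ] A,
      ∀ g, f (AugmentedDownUpAlgebra.gen τ (-1) 0 (downUpPhi τ) g)
        = downUpGenImage τ K K' L R C₁ C₂ g := by
  have hinv {C : A} (h : Commute C K) : Commute C K' := by
    calc C * K' = K' * K * C * K' := by rw [hK'K, one_mul]
      _ = K' * C := by rw [mul_assoc K', ← h.eq, mul_assoc, mul_assoc, hKK', mul_one]
  have h1L : Commute C₁ L := hC₁ ▸ commute_casimir_one_lowering hq hq1 hKL hL
  have h1R : Commute C₁ R := hC₁ ▸ commute_casimir_one_raising hq hq1 hRK hR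
  have h1K : Commute C₁ K := hC₁ ▸ commute_casimir_one_cartan hq hKL hRK _ _
  have h2L : Commute C₂ L := hC₂ ▸ commute_casimir_two_lowering hKL hL
  have h2R : Commute C₂ R := hC₂ ▸ commute_casimir_two_raising hq hRK hR
  have h2K : Commute C₂ K := hC₂ ▸ commute_casimir_two_cartan hq hKL hRK
  have h21 : Commute C₂ C₁ := by
    rw [hC₁]
    exact ((h2K.smul_right _).add_right (h2R.mul_right h2L)).sub_right
      ((h2L.mul_right h2R).smul_right _)
  have hCK' : C₂ * K' = K + (τ ^ 2 - 1) • (R * L) - (τ ^ 2 - 1) • (L * R) := by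
    rw [hC₂, sub_mul, add_mul, smul_mul_assoc, smul_mul_assoc, pow_two, mul_assoc K, hKK',
      mul_assoc _ K, hKK', mul_assoc _ K, hKK', mul_one, mul_one, mul_one]
  have hτ : τ ≠ 0 := fun e => hq (by simp [e])
  refine ⟨RingQuot.liftAlgHom ℂ ⟨FreeAlgebra.lift ℂ (downUpGenImage τ K K' L R C₁ C₂), ?_⟩,
    fun g => ?_⟩
  · intro x y hxy
    cases hxy with
    | K_mul_Kinv => simpa [downUpGenImage] using hKK'
    | Kinv_mul_K => simpa [downUpGenImage] using hK'K
    | Cs_central x =>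
      rw [map_mul, map_mul, FreeAlgebra.lift_ι_apply]
      refine FreeAlgebra.commute_lift_of_commute_generators (fun i => ?_) x
      refine Commute.smul_left ?_ _
      cases i
      exacts [h2K, hinv h2K, h2L, h2R, (Commute.refl _).smul_right _, h21.smul_right _]
    | Ct_central x =>
      rw [map_mul, map_mul, FreeAlgebra.lift_ι_apply]
      refine FreeAlgebra.commute_lift_of_commute_generators (fun i => ?_) x
      refine Commute.smul_left ?_ _
      cases i
      exacts [h1K, hinv h1K, h1L, h1R, h21.symm.smul_right _, (Commute.refl _).smul_right _]
    | K_mul_E => simpa [downUpGenImage] using hKL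
    | K_mul_F =>
      simp only [map_mul, map_smul, FreeAlgebra.lift_ι_apply, downUpGenImage]
      rw [hRK, smul_smul, zpow_neg, zpow_ofNat, inv_mul_cancel₀ hq, one_smul]
    | F_mul_E =>
      rw [evalK_downUpPhi]
      simp only [AugmentedDownUp.powK, map_mul, map_add, map_smul,
        FreeAlgebra.lift_ι_apply, downUpGenImage, smul_mul_assoc]
      norm_num [FreeAlgebra.lift_ι_apply, downUpGenImage]
      rw [hCK', hC₁]
      match_scalars <;> field_simp <;> ring
    | E_mul_F =>
      rw [evalK_downUpPhi]
      simp only [AugmentedDownUp.powK, map_mul, map_add, map_smul,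
        FreeAlgebra.lift_ι_apply, downUpGenImage, smul_mul_assoc]
      norm_num [FreeAlgebra.lift_ι_apply, downUpGenImage]
      rw [hCK', hC₁]
      match_scalars <;> field_simp <;> ring
  · rw [AugmentedDownUpAlgebra.gen, RingQuot.liftAlgHom_mkAlgHom_apply, FreeAlgebra.lift_ι_apply]

end Representation

/-! ### Matrix entries and the down-up relation -/

namespace AttenuatedSpace

open Module

variable {F : Type*} [Field F] {H : Type*} [AddCommGroup H] [Module F H] {h : Submodule F H}

theorem inf_eq_bot_of_le {a b : Submodule F H} (hab : a ≤ b) (hb : b ⊓ h = ⊥) : a ⊓ h = ⊥ :=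
  le_bot_iff.1 (hb ▸ inf_le_inf_right h hab)

theorem transpose_lowering : (lowering h).transpose = raising h := rfl

theorem transpose_raising : (raising h).transpose = lowering h := rfl

/-- Modular law: if w ≤ y + h then w = y + (h ∩ w), while the covering leaves only `y` and `w` as
values of y + (w ∩ h). This turns membership of a cover in the poset into the non-containment
condition that `Submodule.ncard_covBy_le_not_le` counts. -/
theorem inf_eq_bot_iff_not_le_sup {y w : Submodule F H} (hy : y ⊓ h = ⊥) (hyw : y ⋖ w) :
    w ⊓ h = ⊥ ↔ ¬ w ≤ y ⊔ h := by
  constructor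
  · intro hw hle
    have e : y ⊔ h ⊓ w = w := by rw [← sup_inf_assoc_of_le h hyw.le, inf_eq_right.2 hle]
    rw [inf_comm, hw, sup_bot_eq] at e
    exact hyw.ne e
  · intro hle
    by_contra hw
    apply hle
    rcases hyw.eq_or_eq (c := y ⊔ w ⊓ h) le_sup_left (sup_le hyw.le inf_le_left) with e | e
    · have : w ⊓ h ≤ y := e ▸ le_sup_right
      exact absurd (le_bot_iff.1 (hy ▸ le_inf this inf_le_right)) hw
    · rw [← e]
      exact sup_le_sup_left inf_le_right y

section

variable [Module.Finite F H]

theorem covBy_iff {x y : AttenuatedSpace h} :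
    x ⋖ y ↔ x.1 ≤ y.1 ∧ finrank F y.1 = finrank F x.1 + 1 := by
  rw [← Submodule.covBy_iff_le_and_finrank_eq]
  -- The poset is closed under passing to subspaces, so nothing between two of its elements is lost
  -- and its covers are covers of subspaces.
  refine (Set.OrdConnected.apply_covBy_apply_iff
    (OrderEmbedding.subtype fun x : Submodule F H => x ⊓ h = ⊥) ?_).symm
  refine ⟨?_⟩
  rintro _ ⟨a, rfl⟩ _ ⟨b, rfl⟩ c ⟨-, hcb⟩
  exact ⟨⟨c, inf_eq_bot_of_le hcb b.2⟩, rfl⟩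

open Classical in
theorem lowering_apply (x y : AttenuatedSpace h) :
    lowering h x y = if x.1 ≤ y.1 ∧ finrank F y.1 = finrank F x.1 + 1 then 1 else 0 := by
  simp only [lowering, Matrix.of_apply, covBy_iff]

open Classical in
theorem raising_apply (x y : AttenuatedSpace h) :
    raising h x y = if y.1 ≤ x.1 ∧ finrank F x.1 = finrank F y.1 + 1 then 1 else 0 := by
  simp only [raising, Matrix.of_apply, covBy_iff]

theorem finrank_le {N M : ℕ} (hH : finrank F H = N + M) (hh : finrank F h = M)
    (x : AttenuatedSpace h) : finrank F x.1 ≤ N := by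
  have h1 := Submodule.finrank_sup_add_finrank_inf_eq x.1 h
  have h2 := Submodule.finrank_le (x.1 ⊔ h)
  rw [x.2, finrank_bot] at h1
  omega

theorem matK_eq_diagonal {N M : ℕ} (hH : finrank F H = N + M) (hh : finrank F h = M) :
    matK h N M = Matrix.diagonal fun y : AttenuatedSpace h =>
      (Nat.card F : ℂ) ^ ((N : ℤ) + (M : ℤ) - (finrank F y.1 : ℤ)) := by
  ext x y
  rw [matK, Matrix.sum_apply, Matrix.diagonal_apply]
  split_ifs with hxy
  · subst hxy
    rw [Finset.sum_eq_single (finrank F x.1)]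
    · simp [proj]
    · intro i _ hi
      simp [proj, hi.symm]
    · intro hx
      exact absurd (Finset.mem_range.2 (Nat.lt_succ_of_le (finrank_le hH hh x))) hx
  · exact Finset.sum_eq_zero fun i _ => by simp [proj, hxy]

end

/-! ### Counting covers inside the poset -/

variable [Finite F] [Module.Finite F H]

theorem card_ne_zero : (Nat.card F : ℂ) ≠ 0 := Nat.cast_ne_zero.2 Nat.card_pos.ne'

theorem card_sub_one_ne_zero : (Nat.card F : ℂ) - 1 ≠ 0 :=
  sub_ne_zero.2 (Nat.cast_ne_one.2 Finite.one_lt_card.ne')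

theorem sum_boole_eq_ncard (p : Submodule F H → Prop)
    [∀ w : AttenuatedSpace h, Decidable (p w.1)] :
    (∑ w : AttenuatedSpace h, if p w.1 then (1 : ℂ) else 0)
      = ({w : Submodule F H | w ⊓ h = ⊥ ∧ p w}.ncard : ℂ) := by
  rw [Finset.sum_boole]
  congr 1
  rw [← Set.ncard_coe_finset, ← Set.ncard_image_of_injective _ Subtype.val_injective]
  congr 1
  ext w
  simp [and_comm]

/-- The number of elements of the poset that cover `x`. -/
noncomputable def upDegree (x : AttenuatedSpace h) : ℂ :=
  (lowering h * raising h) x x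

/-- Vector count with a = y, c = y + h and b = H, where dim (y + h) = dim y + M because `y` meets
`h` trivially. -/
theorem upDegree_mul {N M : ℕ} (hH : finrank F H = N + M) (hh : finrank F h = M)
    (y : AttenuatedSpace h) :
    upDegree y * ((Nat.card F : ℂ) ^ (finrank F y.1 + 1) - (Nat.card F : ℂ) ^ finrank F y.1)
      = (Nat.card F : ℂ) ^ (N + M) - (Nat.card F : ℂ) ^ (finrank F y.1 + M) := by
  classical
  have h1 := Submodule.finrank_sup_add_finrank_inf_eq y.1 h
  rw [y.2, finrank_bot, hh, add_zero] at h1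
  rw [← h1, ← hH, ← finrank_top F H,
    ← Submodule.ncard_covBy_le_not_le (le_sup_left : y.1 ≤ y.1 ⊔ h) le_top]
  congr 1
  rw [upDegree, Matrix.mul_apply]
  simp only [lowering_apply, raising_apply, ite_mul, one_mul, zero_mul, ← ite_and, and_self]
  rw [sum_boole_eq_ncard fun w => y.1 ≤ w ∧ finrank F w = finrank F y.1 + 1]
  congr 2
  ext w
  simp only [Set.mem_ofPred_eq, ← Submodule.covBy_iff_le_and_finrank_eq, le_top, true_and]
  rw [and_comm]
  exact and_congr_right fun hw => inf_eq_bot_iff_not_le_sup y.2 hw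

/-- An element of dimension k has (q^(N+M-k) - q^M)/(q - 1) covers; the term q^M cancels in the
difference. -/
theorem upDegree_sub_upDegree {N M : ℕ} (hH : finrank F H = N + M) (hh : finrank F h = M)
    {x y : AttenuatedSpace h} (hr : finrank F y.1 = finrank F x.1 + 1) :
    upDegree x - upDegree y = (Nat.card F : ℂ) ^ ((N : ℤ) + (M : ℤ) - (finrank F y.1 : ℤ)) := by
  have hx := upDegree_mul hH hh x
  have hy := upDegree_mul hH hh y
  have hq := card_ne_zero (F := F)
  have hq1 := card_sub_one_ne_zero (F := F)
  rw [zpow_sub₀ hq, zpow_natCast, ← Nat.cast_add, zpow_natCast,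
    eq_div_iff (pow_ne_zero _ hq)]
  refine mul_right_cancel₀ hq1 ?_
  rw [hr] at hy ⊢
  linear_combination (Nat.card F : ℂ) * hx - hy

theorem ncard_covBy_le {a b : Submodule F H} (hab : a ≤ b)
    (hr : finrank F b = finrank F a + 2) :
    ({w : Submodule F H | a ⋖ w ∧ w ≤ b}.ncard : ℂ) = (Nat.card F : ℂ) + 1 := by
  -- With c = a the condition of not lying in `c` is automatic for a cover of `a`.
  have h1 := Submodule.ncard_covBy_le_not_le (le_refl a) hab
  have e : {w : Submodule F H | a ⋖ w ∧ w ≤ b ∧ ¬ w ≤ a} = {w | a ⋖ w ∧ w ≤ b} := by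
    ext w
    simp only [Set.mem_ofPred_eq]
    exact ⟨fun hw => ⟨hw.1, hw.2.1⟩, fun hw => ⟨hw.1, hw.2, hw.1.lt.not_ge⟩⟩
  rw [e, hr] at h1
  have hq := card_ne_zero (F := F)
  have hq1 := card_sub_one_ne_zero (F := F)
  refine mul_right_cancel₀ (mul_ne_zero (pow_ne_zero (finrank F a) hq) hq1) ?_
  linear_combination h1

/-! ### Entries of products of two lowering and raising matrices -/

open Classical in
theorem lowering_mul_lowering_apply (x y : AttenuatedSpace h) :
    (lowering h * lowering h) x y
      = if x.1 ≤ y.1 ∧ finrank F y.1 = finrank F x.1 + 2 then (Nat.card F : ℂ) + 1 else 0 := by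
  rw [Matrix.mul_apply]
  simp only [lowering_apply]
  split_ifs with hxy
  · rw [← ncard_covBy_le hxy.1 hxy.2]
    have e : {w : Submodule F H | x.1 ⋖ w ∧ w ≤ y.1}
        = {w | w ⊓ h = ⊥ ∧ x.1 ⋖ w ∧ w ≤ y.1} := by
      ext w
      simp only [Set.mem_ofPred_eq]
      exact ⟨fun hw => ⟨inf_eq_bot_of_le hw.2 y.2, hw⟩, fun hw => hw.2⟩
    rw [e, ← sum_boole_eq_ncard]
    refine Finset.sum_congr rfl fun w _ => ?_
    simp only [Submodule.covBy_iff_le_and_finrank_eq, mul_ite, mul_one, mul_zero, ← ite_and]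
    refine if_congr ?_ rfl rfl
    constructor
    · rintro ⟨⟨h1, -⟩, h2, h3⟩
      exact ⟨⟨h2, h3⟩, h1⟩
    · rintro ⟨⟨h1, h2⟩, h3⟩
      exact ⟨⟨h3, by omega⟩, h1, h2⟩
  · refine Finset.sum_eq_zero fun w _ => ?_
    by_contra hne
    simp only [mul_ite, mul_one, mul_zero, ite_eq_right_iff, Classical.not_imp] at hne
    exact hxy ⟨hne.2.1.1.trans hne.1.1, by have := hne.1.2; have := hne.2.1.2; omega⟩

open Classical in
-- Two distinct subspaces have at most one common lower cover, their intersection, and it always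
-- lies in the poset.
theorem raising_mul_lowering_apply_of_ne {x y : AttenuatedSpace h} (hxy : x ≠ y) :
    (raising h * lowering h) x y
      = if finrank F x.1 = finrank F (x.1 ⊓ y.1 : Submodule F H) + 1
          ∧ finrank F y.1 = finrank F x.1 then 1 else 0 := by
  rw [Matrix.mul_apply]
  simp only [lowering_apply, raising_apply]
  have key (u : Submodule F H) (h1 : u ≤ x.1) (h2 : finrank F x.1 = finrank F u + 1)
      (h3 : u ≤ y.1) (h4 : finrank F y.1 = finrank F u + 1) : u = x.1 ⊓ y.1 := by
    refine (((Submodule.covBy_iff_le_and_finrank_eq.2 ⟨h1, h2⟩).eq_or_eq (le_inf h1 h3)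
      inf_le_left).resolve_right fun e => hxy (Subtype.ext ?_)).symm
    exact Submodule.eq_of_le_of_finrank_eq (inf_eq_left.1 e) (h2.trans h4.symm)
  split_ifs with hr
  · rw [Finset.sum_eq_single ⟨x.1 ⊓ y.1, inf_eq_bot_of_le inf_le_left x.2⟩]
    · rw [if_pos ⟨inf_le_left, hr.1⟩, if_pos ⟨inf_le_right, hr.2.trans hr.1⟩, mul_one]
    · intro u _ hu
      by_contra hne
      simp only [mul_ite, mul_one, mul_zero, ite_eq_right_iff, Classical.not_imp] at hne
      exact hu (Subtype.ext (key u.1 hne.2.1.1 hne.2.1.2 hne.1.1 hne.1.2))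
    · exact fun hu => absurd (Finset.mem_univ _) hu
  · refine Finset.sum_eq_zero fun u _ => ?_
    by_contra hne
    simp only [mul_ite, mul_one, mul_zero, ite_eq_right_iff, Classical.not_imp] at hne
    obtain ⟨⟨h3, h4⟩, ⟨h1, h2⟩, -⟩ := hne
    rw [← key u.1 h1 h2 h3 h4] at hr
    exact hr ⟨h2, h4.trans h2.symm⟩

/-- The only possible common cover of `x` and `v` is their sum; the element `y` witnesses that this
sum lies in the poset. -/
theorem lowering_mul_raising_apply_of_covBy {x v y : AttenuatedSpace h} (hxv : x ≠ v)
    (hxy : x ⋖ y) (hvy : v ⋖ y) : (lowering h * raising h) x v = 1 := by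
  classical
  rw [covBy_iff] at hxy hvy
  rw [Matrix.mul_apply, Finset.sum_eq_single y]
  · rw [lowering_apply, raising_apply, if_pos hxy, if_pos hvy, mul_one]
  · intro w _ hw
    by_contra hne
    simp only [lowering_apply, raising_apply, mul_ite, mul_one, mul_zero, ite_eq_right_iff,
      Classical.not_imp] at hne
    obtain ⟨h1, h2, -⟩ := hne
    have hne' : x.1 ≠ v.1 := fun e => hxv (Subtype.ext e)
    rw [← Submodule.covBy_iff_le_and_finrank_eq] at h1 h2 hxy hvy
    exact hw (Subtype.ext ((h2.wcovBy.sup_eq h1.wcovBy hne').symm.trans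
      (hxy.wcovBy.sup_eq hvy.wcovBy hne')))
  · exact fun hy => absurd (Finset.mem_univ _) hy

theorem raising_mul_lowering_apply_of_covBy {x v y : AttenuatedSpace h} (hxv : x ≠ v)
    (hxy : x ⋖ y) (hvy : v ⋖ y) : (raising h * lowering h) x v = 1 := by
  classical
  rw [covBy_iff] at hxy hvy
  rw [raising_mul_lowering_apply_of_ne hxv, if_pos]
  have hne' : x.1 ≠ v.1 := fun e => hxv (Subtype.ext e)
  have hs := (Submodule.covBy_iff_le_and_finrank_eq.2 hxy).wcovBy.sup_eq
    (Submodule.covBy_iff_le_and_finrank_eq.2 hvy).wcovBy hne'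
  have := Submodule.finrank_sup_add_finrank_inf_eq x.1 v.1
  rw [hs] at this
  omega

/-! ### The down-up relation, entry by entry -/

open Classical in
-- Applied to the row of `x` in `RL` and in `LR`: off the diagonal both are 1 below `y`, so both
-- products share the same remaining sum.
theorem sum_mul_lowering {x y : AttenuatedSpace h} (hxy : x ⋖ y) {f : AttenuatedSpace h → ℂ}
    (hf : ∀ v, x ≠ v → v ⋖ y → f v = 1) :
    ∑ v, f v * lowering h v y
      = f x + ∑ v : AttenuatedSpace h, if x ≠ v ∧ v ⋖ y then 1 else 0 := by
  have hx : f x = ∑ v, if x = v then f x else 0 := by rw [Finset.sum_ite_eq]; simp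
  rw [hx, ← Finset.sum_add_distrib]
  refine Finset.sum_congr rfl fun v _ => ?_
  simp only [lowering_apply, ← covBy_iff]
  by_cases hv : x = v
  · subst hv; simp [hxy]
  · by_cases hvy : v ⋖ y
    · simp [hv, hvy, hf v hv hvy]
    · simp [hv, hvy]

/-- Let d = (RL)ₓₓ, let S be the number of lower covers of `y` other than `x`, and let up denote
`upDegree`. The entries of `RL²`, `LRL`, `L²R` are (q + 1)d, up(x) + S and (q + 1)up(y). Expanding
`RL²` also as (RL)L gives (q + 1)d = d + S, so S = qd, and only -(q + 1)(up(x) - up(y)) survives. -/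
theorem lowering_relation_apply_of_covBy {N M : ℕ} (hH : finrank F H = N + M)
    (hh : finrank F h = M) {x y : AttenuatedSpace h} (hxy : x ⋖ y) :
    (Nat.card F : ℂ) * (raising h * (lowering h * lowering h)) x y
        - ((Nat.card F : ℂ) + 1) * (lowering h * (raising h * lowering h)) x y
        + (lowering h * (lowering h * raising h)) x y
      = -(((Nat.card F : ℂ) + 1)
          * (Nat.card F : ℂ) ^ ((N : ℤ) + (M : ℤ) - (finrank F y.1 : ℤ))) := by
  classical
  have hc := covBy_iff.1 hxy
  have h1 : (raising h * (lowering h * lowering h)) x y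
      = (raising h * lowering h) x x * ((Nat.card F : ℂ) + 1) := by
    rw [Matrix.mul_apply, Matrix.mul_apply, Finset.sum_mul]
    refine Finset.sum_congr rfl fun u _ => ?_
    rw [lowering_mul_lowering_apply, raising_apply, lowering_apply]
    by_cases hu : u.1 ≤ x.1 ∧ finrank F x.1 = finrank F u.1 + 1
    · rw [if_pos hu, if_pos ⟨hu.1.trans hc.1, by omega⟩, one_mul, one_mul, one_mul]
    · rw [if_neg hu, zero_mul, zero_mul, zero_mul]
  have h2 := sum_mul_lowering hxy (f := (raising h * lowering h) x)
    fun v hv hvy => raising_mul_lowering_apply_of_covBy hv hxy hvy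
  have h3 := sum_mul_lowering hxy (f := (lowering h * raising h) x)
    fun v hv hvy => lowering_mul_raising_apply_of_covBy hv hxy hvy
  rw [← Matrix.mul_apply, Matrix.mul_assoc] at h2 h3
  have h4 : (lowering h * (lowering h * raising h)) x y
      = ((Nat.card F : ℂ) + 1) * upDegree y := by
    rw [← Matrix.mul_assoc, Matrix.mul_apply, upDegree, Matrix.mul_apply, Finset.mul_sum]
    refine Finset.sum_congr rfl fun w _ => ?_
    rw [lowering_mul_lowering_apply, raising_apply, lowering_apply]
    by_cases hw : y.1 ≤ w.1 ∧ finrank F w.1 = finrank F y.1 + 1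
    · rw [if_pos hw, if_pos ⟨hc.1.trans hw.1, by omega⟩, mul_one, mul_one, mul_one]
    · rw [if_neg hw, mul_zero, mul_zero, mul_zero]
  have h5 := upDegree_sub_upDegree hH hh hc.2
  rw [h1] at h2
  rw [h1, h3, h4, ← h5, ← upDegree]
  linear_combination ((Nat.card F : ℂ) + 1) * h2

theorem lowering_relation_apply_of_not_le {x y : AttenuatedSpace h} (hxy : ¬ x.1 ≤ y.1)
    (hr : finrank F y.1 = finrank F x.1 + 1) :
    (Nat.card F : ℂ) * (raising h * (lowering h * lowering h)) x y
        - ((Nat.card F : ℂ) + 1) * (lowering h * (raising h * lowering h)) x y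
        + (lowering h * (lowering h * raising h)) x y = 0 := by
  classical
  have hdim := Submodule.finrank_sup_add_finrank_inf_eq x.1 y.1
  have hys : finrank F y.1 < finrank F (x.1 ⊔ y.1 : Submodule F H) :=
    Submodule.finrank_lt_finrank_of_lt (right_lt_sup.2 hxy)
  -- For `w` covering `x`, the factor `RL` is 1 exactly when `w` and `y` meet in codimension 1, that
  -- is, when w + y has dimension dim y + 1 and so equals x + y.
  have hLRL (w : AttenuatedSpace h) :
      lowering h x w * (raising h * lowering h) w y
        = if x.1 ⋖ w.1 ∧ w.1 ≤ x.1 ⊔ y.1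
            ∧ finrank F (x.1 ⊔ y.1 : Submodule F H) = finrank F y.1 + 1 then 1 else 0 := by
    simp only [lowering_apply, ← Submodule.covBy_iff_le_and_finrank_eq]
    by_cases hw : x.1 ⋖ w.1
    · have hwy : w ≠ y := fun e => hxy (e ▸ hw.le)
      have hwr := (Submodule.covBy_iff_le_and_finrank_eq.1 hw).2
      have hle : x.1 ⊔ y.1 ≤ w.1 ⊔ y.1 := sup_le_sup_right hw.le _
      have hm := Submodule.finrank_mono hle
      have hd := Submodule.finrank_sup_add_finrank_inf_eq w.1 y.1
      rw [raising_mul_lowering_apply_of_ne hwy, if_pos hw, one_mul]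
      refine if_congr ⟨fun hi => ?_, fun hi => ?_⟩ rfl rfl
      · have e := Submodule.eq_of_le_of_finrank_le hle (by omega)
        exact ⟨hw, e ▸ le_sup_left, by omega⟩
      · have e := le_antisymm (sup_le hi.2.1 le_sup_right) hle
        rw [e] at hd
        omega
    · rw [if_neg hw, zero_mul, if_neg fun hi => hw hi.1]
  have hRLL (u : AttenuatedSpace h) :
      raising h x u * (lowering h * lowering h) u y
        = if finrank F (x.1 ⊔ y.1 : Submodule F H) = finrank F y.1 + 1 ∧ u.1 = x.1 ⊓ y.1
          then (Nat.card F : ℂ) + 1 else 0 := by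
    rw [raising_apply, lowering_mul_lowering_apply, ite_mul, one_mul, zero_mul, ← ite_and]
    refine if_congr ⟨?_, ?_⟩ rfl rfl
    · rintro ⟨⟨h1, h2⟩, h3, h4⟩
      have hle : u.1 ≤ x.1 ⊓ y.1 := le_inf h1 h3
      have hm := Submodule.finrank_mono hle
      exact ⟨by omega, Submodule.eq_of_le_of_finrank_le hle (by omega)⟩
    · rintro ⟨h1, h2⟩
      rw [h2]
      exact ⟨⟨inf_le_left, by omega⟩, inf_le_right, by omega⟩
  have hLLR (w : AttenuatedSpace h) :
      (lowering h * lowering h) x w * raising h w y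
        = if finrank F (x.1 ⊔ y.1 : Submodule F H) = finrank F y.1 + 1 ∧ w.1 = x.1 ⊔ y.1
          then (Nat.card F : ℂ) + 1 else 0 := by
    rw [raising_apply, lowering_mul_lowering_apply, mul_ite, mul_one, mul_zero, ← ite_and]
    refine if_congr ⟨?_, ?_⟩ rfl rfl
    · rintro ⟨⟨h1, h2⟩, h3, h4⟩
      have hle : x.1 ⊔ y.1 ≤ w.1 := sup_le h3 h1
      have hm := Submodule.finrank_mono hle
      exact ⟨by omega, (Submodule.eq_of_le_of_finrank_le hle (by omega)).symm⟩
    · rintro ⟨h1, h2⟩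
      rw [h2]
      exact ⟨⟨le_sup_right, h1⟩, le_sup_left, by omega⟩
  rw [← Matrix.mul_assoc (lowering h) (lowering h), Matrix.mul_apply, Matrix.mul_apply,
    Matrix.mul_apply (M := lowering h * lowering h)]
  simp only [hLRL, hRLL, hLLR]
  by_cases hs : finrank F (x.1 ⊔ y.1 : Submodule F H) = finrank F y.1 + 1
  swap
  · simp [hs]
  simp only [hs, and_true, true_and]
  have e1 : (∑ u : AttenuatedSpace h, if u.1 = x.1 ⊓ y.1 then (Nat.card F : ℂ) + 1 else 0)
      = (Nat.card F : ℂ) + 1 := by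
    rw [Finset.sum_eq_single ⟨x.1 ⊓ y.1, inf_eq_bot_of_le inf_le_left x.2⟩]
    · simp
    · exact fun u _ hu => if_neg fun e => hu (Subtype.ext e)
    · exact fun hu => absurd (Finset.mem_univ _) hu
  rw [e1, sum_boole_eq_ncard fun w => x.1 ⋖ w ∧ w ≤ x.1 ⊔ y.1]
  -- If x + y is in the poset, the sum is q(q + 1) - (q + 1)² + (q + 1) = 0. Otherwise it is q(q +
  -- 1) - (q + 1)q + 0 = 0, because exactly one of the q + 1 covers of `x` inside x + y meets `h`.
  by_cases hsh : (x.1 ⊔ y.1) ⊓ h = ⊥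
  · have e2 : (∑ u : AttenuatedSpace h, if u.1 = x.1 ⊔ y.1 then (Nat.card F : ℂ) + 1 else 0)
        = (Nat.card F : ℂ) + 1 := by
      rw [Finset.sum_eq_single ⟨x.1 ⊔ y.1, hsh⟩]
      · simp
      · exact fun u _ hu => if_neg fun e => hu (Subtype.ext e)
      · exact fun hu => absurd (Finset.mem_univ _) hu
    have e3 : {w : Submodule F H | w ⊓ h = ⊥ ∧ x.1 ⋖ w ∧ w ≤ x.1 ⊔ y.1}
        = {w | x.1 ⋖ w ∧ w ≤ x.1 ⊔ y.1} := by
      ext w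
      simp only [Set.mem_ofPred_eq]
      exact ⟨fun hw => hw.2, fun hw => ⟨inf_eq_bot_of_le hw.2 hsh, hw⟩⟩
    rw [e2, e3, ncard_covBy_le le_sup_left (by omega)]
    ring
  · have e2 : (∑ u : AttenuatedSpace h, if u.1 = x.1 ⊔ y.1 then (Nat.card F : ℂ) + 1 else 0)
        = 0 :=
      Finset.sum_eq_zero fun u _ => if_neg fun e : u.1 = x.1 ⊔ y.1 => hsh (e ▸ u.2)
    have e3 : {w : Submodule F H | w ⊓ h = ⊥ ∧ x.1 ⋖ w ∧ w ≤ x.1 ⊔ y.1}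
        = {w | x.1 ⋖ w ∧ w ≤ x.1 ⊔ y.1 ∧ ¬ w ≤ (x.1 ⊔ h) ⊓ (x.1 ⊔ y.1)} := by
      ext w
      simp only [Set.mem_ofPred_eq]
      constructor
      · rintro ⟨h1, h2, h3⟩
        exact ⟨h2, h3, fun hle =>
          (inf_eq_bot_iff_not_le_sup x.2 h2).1 h1 (hle.trans inf_le_left)⟩
      · rintro ⟨h2, h3, h4⟩
        exact ⟨(inf_eq_bot_iff_not_le_sup x.2 h2).2 fun hle => h4 (le_inf hle h3), h2, h3⟩
    -- This intersection is x + (h ∩ (x + y)). The space h ∩ (x + y) is nonzero, and it is at most a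
    -- line because it meets `y` trivially inside x + y, where `y` has codimension 1.
    have hc : finrank F ((x.1 ⊔ h) ⊓ (x.1 ⊔ y.1) : Submodule F H) = finrank F x.1 + 1 := by
      rw [sup_inf_assoc_of_le h (le_sup_left : x.1 ≤ x.1 ⊔ y.1)]
      have d1 := Submodule.finrank_sup_add_finrank_inf_eq x.1 (h ⊓ (x.1 ⊔ y.1))
      have d2 := Submodule.finrank_sup_add_finrank_inf_eq y.1 (h ⊓ (x.1 ⊔ y.1))
      have i1 : x.1 ⊓ (h ⊓ (x.1 ⊔ y.1)) = ⊥ := by rw [← inf_assoc, x.2, bot_inf_eq]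
      have i2 : y.1 ⊓ (h ⊓ (x.1 ⊔ y.1)) = ⊥ := by rw [← inf_assoc, y.2, bot_inf_eq]
      rw [i1, finrank_bot] at d1
      rw [i2, finrank_bot] at d2
      have m := Submodule.finrank_mono (sup_le le_sup_right inf_le_right :
        y.1 ⊔ h ⊓ (x.1 ⊔ y.1) ≤ x.1 ⊔ y.1)
      have pos : finrank F (h ⊓ (x.1 ⊔ y.1) : Submodule F H) ≠ 0 := by
        rw [Ne, Submodule.finrank_eq_zero, inf_comm]
        exact hsh
      omega
    have hcount := Submodule.ncard_covBy_le_not_le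
      (le_inf le_sup_left le_sup_left : x.1 ≤ (x.1 ⊔ h) ⊓ (x.1 ⊔ y.1)) inf_le_right
    rw [hc, hs, hr] at hcount
    have hq := card_ne_zero (F := F)
    have hq1 := card_sub_one_ne_zero (F := F)
    rw [e2, e3]
    refine mul_right_cancel₀ (mul_ne_zero (pow_ne_zero (finrank F x.1) hq) hq1) ?_
    linear_combination -((Nat.card F : ℂ) + 1) * hcount

/-! ### The relations as matrix identities -/

theorem mul_mul_apply_eq_zero {A B C : Matrix (AttenuatedSpace h) (AttenuatedSpace h) ℂ}
    {a b c : ℤ}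
    (hA : ∀ x y, A x y ≠ 0 → (finrank F y.1 : ℤ) = finrank F x.1 + a)
    (hB : ∀ x y, B x y ≠ 0 → (finrank F y.1 : ℤ) = finrank F x.1 + b)
    (hC : ∀ x y, C x y ≠ 0 → (finrank F y.1 : ℤ) = finrank F x.1 + c)
    {x y : AttenuatedSpace h} (hxy : (finrank F y.1 : ℤ) ≠ finrank F x.1 + (a + b + c)) :
    (A * (B * C)) x y = 0 := by
  rw [Matrix.mul_apply]
  refine Finset.sum_eq_zero fun u _ => ?_
  rw [Matrix.mul_apply, Finset.mul_sum]
  refine Finset.sum_eq_zero fun v _ => ?_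
  by_contra hne
  have h1 := hA _ _ (left_ne_zero_of_mul hne)
  have h2 := hB _ _ (left_ne_zero_of_mul (right_ne_zero_of_mul hne))
  have h3 := hC _ _ (right_ne_zero_of_mul (right_ne_zero_of_mul hne))
  omega

theorem lowering_relation {N M : ℕ} (hH : finrank F H = N + M) (hh : finrank F h = M) :
    (Nat.card F : ℂ) • (raising h * (lowering h * lowering h))
        - ((Nat.card F : ℂ) + 1) • (lowering h * (raising h * lowering h))
        + lowering h * (lowering h * raising h)
      = -(((Nat.card F : ℂ) + 1) • (lowering h * matK h N M)) := by
  classical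
  ext x y
  simp only [Matrix.add_apply, Matrix.sub_apply, Matrix.neg_apply, Matrix.smul_apply,
    smul_eq_mul, matK_eq_diagonal hH hh, Matrix.mul_diagonal]
  by_cases hr : finrank F y.1 = finrank F x.1 + 1
  · by_cases hxy : x.1 ≤ y.1
    · rw [lowering_apply, if_pos ⟨hxy, hr⟩, one_mul]
      exact lowering_relation_apply_of_covBy hH hh (covBy_iff.2 ⟨hxy, hr⟩)
    · rw [lowering_apply, if_neg fun e => hxy e.1, zero_mul, mul_zero, neg_zero]
      exact lowering_relation_apply_of_not_le hxy hr
  · have hl (x y : AttenuatedSpace h) (hne : lowering h x y ≠ 0) :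
        (finrank F y.1 : ℤ) = finrank F x.1 + 1 := by
      rw [lowering_apply, ite_ne_right_iff] at hne
      exact_mod_cast hne.1.2
    have hra (x y : AttenuatedSpace h) (hne : raising h x y ≠ 0) :
        (finrank F y.1 : ℤ) = finrank F x.1 + (-1) := by
      rw [raising_apply, ite_ne_right_iff] at hne
      have := hne.1.2
      omega
    rw [mul_mul_apply_eq_zero hra hl hl (by omega), mul_mul_apply_eq_zero hl hra hl (by omega),
      mul_mul_apply_eq_zero hl hl hra (by omega), lowering_apply, if_neg fun e => hr e.2]
    simp

/-- Transposition exchanges `L` and `R` and fixes the diagonal matrix `K`. -/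
theorem raising_relation {N M : ℕ} (hH : finrank F H = N + M) (hh : finrank F h = M) :
    (Nat.card F : ℂ) • (raising h * (raising h * lowering h))
        - ((Nat.card F : ℂ) + 1) • (raising h * (lowering h * raising h))
        + lowering h * (raising h * raising h)
      = -(((Nat.card F : ℂ) + 1) • (matK h N M * raising h)) := by
  have := congrArg Matrix.transpose (lowering_relation hH hh)
  rw [matK_eq_diagonal hH hh] at this ⊢
  simpa only [Matrix.transpose_add, Matrix.transpose_sub, Matrix.transpose_neg,
    Matrix.transpose_smul, Matrix.transpose_mul, transpose_lowering, transpose_raising,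
    Matrix.diagonal_transpose, Matrix.mul_assoc] using this

theorem matK_mul_lowering {N M : ℕ} (hH : finrank F H = N + M) (hh : finrank F h = M) :
    matK h N M * lowering h = (Nat.card F : ℂ) • (lowering h * matK h N M) := by
  classical
  ext x y
  rw [matK_eq_diagonal hH hh, Matrix.smul_apply, Matrix.diagonal_mul, Matrix.mul_diagonal,
    lowering_apply, smul_eq_mul]
  split_ifs with hxy
  · rw [mul_one, one_mul, ← zpow_one_add₀ card_ne_zero, hxy.2]
    congr 1
    push_cast
    ring
  · simp

theorem raising_mul_matK {N M : ℕ} (hH : finrank F H = N + M) (hh : finrank F h = M) :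
    raising h * matK h N M = (Nat.card F : ℂ) • (matK h N M * raising h) := by
  have := congrArg Matrix.transpose (matK_mul_lowering hH hh)
  rw [matK_eq_diagonal hH hh] at this ⊢
  simpa only [Matrix.transpose_smul, Matrix.transpose_mul, transpose_lowering,
    Matrix.diagonal_transpose] using this

theorem exists_inverse_matK {N M : ℕ} (hH : finrank F H = N + M) (hh : finrank F h = M) :
    ∃ K' : Matrix (AttenuatedSpace h) (AttenuatedSpace h) ℂ,
      matK h N M * K' = 1 ∧ K' * matK h N M = 1 := by
  refine ⟨Matrix.diagonal fun y => ((Nat.card F : ℂ)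
    ^ ((N : ℤ) + (M : ℤ) - (finrank F y.1 : ℤ)))⁻¹, ?_, ?_⟩
  all_goals
    rw [matK_eq_diagonal hH hh, Matrix.diagonal_mul_diagonal, ← Matrix.diagonal_one]
    congr 1
    ext y
    simp [zpow_ne_zero _ (card_ne_zero (F := F))]

end AttenuatedSpace

/-! ### The module structure on `ℂP` -/

theorem mainTheorem10 {F : Type*} [Field F] [Finite F]
    {H : Type*} [AddCommGroup H] [Module F H] [Module.Finite F H]
    (N M : ℕ) (hN : 0 < N) (hM : 0 < M) (hH : Module.finrank F H = N + M)
    (h : Submodule F H) (hh : Module.finrank F h = M)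
    (τ : ℂ) (hτ : τ ^ 2 = (Nat.card F : ℂ)) :
    ∃ _ : Module (AugmentedDownUpAlgebra τ (-1) 0 (downUpPhi τ)) (AttenuatedSpace.CP h),
      IsScalarTower ℂ (AugmentedDownUpAlgebra τ (-1) 0 (downUpPhi τ)) (AttenuatedSpace.CP h) ∧
      ∀ v : AttenuatedSpace.CP h,
        AugmentedDownUpAlgebra.gen τ (-1) 0 (downUpPhi τ) .K • v
          = AttenuatedSpace.act h (AttenuatedSpace.matK h N M) v ∧
        AugmentedDownUpAlgebra.gen τ (-1) 0 (downUpPhi τ) .E • v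
          = AttenuatedSpace.act h (AttenuatedSpace.lowering h) v ∧
        AugmentedDownUpAlgebra.gen τ (-1) 0 (downUpPhi τ) .F • v
          = AttenuatedSpace.act h (AttenuatedSpace.raising h) v ∧
        AugmentedDownUpAlgebra.gen τ (-1) 0 (downUpPhi τ) .Cs • v
          = AttenuatedSpace.act h
              ((-(τ / (τ ^ 2 - 1) ^ 2)) • AttenuatedSpace.matC₂ h N M) v ∧
        AugmentedDownUpAlgebra.gen τ (-1) 0 (downUpPhi τ) .Ct • v
          = AttenuatedSpace.act h
              ((τ ^ 2 / (τ ^ 2 - 1)) • AttenuatedSpace.matC₁ h N M) v := by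
  obtain ⟨K', hKK', hK'K⟩ := AttenuatedSpace.exists_inverse_matK (h := h) hH hh
  have hq : τ ^ 2 ≠ 0 := hτ ▸ AttenuatedSpace.card_ne_zero
  have hq1 : τ ^ 2 - 1 ≠ 0 := hτ ▸ AttenuatedSpace.card_sub_one_ne_zero
  obtain ⟨f, hf⟩ := exists_algHom_augmentedDownUpAlgebra τ hq hq1 hKK' hK'K
    (hτ ▸ AttenuatedSpace.matK_mul_lowering hH hh) (hτ ▸ AttenuatedSpace.raising_mul_matK hH hh)
    (hτ ▸ AttenuatedSpace.lowering_relation hH hh) (hτ ▸ AttenuatedSpace.raising_relation hH hh)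
    (AttenuatedSpace.matC₁ h N M) (AttenuatedSpace.matC₂ h N M)
    (by rw [hτ]; rfl) (by rw [hτ]; rfl)
  let T := Matrix.toLinAlgEquiv (Finsupp.basisSingleOne (R := ℂ) (ι := AttenuatedSpace h))
  let ρ := T.toAlgHom.comp f
  refine ⟨Module.compHom _ ρ.toRingHom, ?_, ?_⟩
  · let _ := Module.compHom (AttenuatedSpace.CP h) ρ.toRingHom
    refine ⟨fun c a v => ?_⟩
    change ρ (c • a) v = c • ρ a v
    rw [map_smul, LinearMap.smul_apply]
  · intro v
    have key (g : AugmentedDownUp.Gen) :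
        ρ (AugmentedDownUpAlgebra.gen τ (-1) 0 (downUpPhi τ) g) v
          = AttenuatedSpace.act h (downUpGenImage τ (AttenuatedSpace.matK h N M) K'
            (AttenuatedSpace.lowering h) (AttenuatedSpace.raising h)
            (AttenuatedSpace.matC₁ h N M) (AttenuatedSpace.matC₂ h N M) g) v := by
      rw [← hf]
      rfl
    exact ⟨key .K, key .E, key .F, key .Cs, key .Ct⟩
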